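/- Let $m,n\ge 0$, $N=m+n$, and put $\bar i=0$ for $1\le i\le m$, $\bar i=1$ for $m<i\le N$. Let $e_{ij}$ be the matrix units of $\mathrm{End}\,\mathbb C^{m|n}$, with parity $\bar i+\bar j$, and let $$R(u)=1-hPu^{-1},\qquad P=\sum_{i,j=1}^{N}(-1)^{\bar j}\,e_{ij}\otimes e_{ji}.$$ The double Yangian ${\rm DY}(\mathfrak{gl}_{m|n})$ is the $h$-adically complete, topologically free, $\mathbb Z_2$-graded unital associative algebra over $\mathbb C[[h]]$ topologically generated by elements $t_{ij}^{(\pm r)}$ ($1\le i,j\le N$, $r\ge 1$) of parity $\bar i+\bar j$, subject to the relations $$R(u-v)T_1^{\pm}(u)T_2^{\pm}(v)=T_2^{\pm}(v)T_1^{\pm}(u)R(u-v),\qquad R(u-v)T_1^{-}(u)T_2^{+}(v)=T_2^{+}(v)T_1^{-}(u)R(u-v),$$ where $T^{\pm}(u)=\sum_{i,j}(-1)^{\bar i\bar j+\bar j}e_{ij}\otimes t^{\pm}_{ij}(u)$, products are taken in the tensor product of superalgebras, and $$t_{ij}^{-}(u)=\delta_{ij}+h\sum_{r\ge1}t_{ij}^{(r)}u^{-r},\qquad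 t_{ij}^{+}(u)=\delta_{ij}-h\sum_{r\ge1}t_{ij}^{(-r)}u^{r-1}.$$ (Precisely: it is the $h$-adic completion of the quotient of the free algebra by the smallest two-sided ideal that contains all coefficients of the relations, multiplied by $u-v$, and has an $h$-torsion free quotient.) The matrices $(t^{\pm}_{ij}(u))_{i,j}$ with entries in ${\rm DY}(\mathfrak{gl}_{m|n})[[u^{\pm1}]]$ have unique Gauss decompositions $T^{\pm}(u)=F^{\pm}(u)D^{\pm}(u)E^{\pm}(u)$ with $F^\pm(u)$ lower unitriangular, $D^\pm(u)=\mathrm{diag}(d_1^\pm(u),\dots,d_N^\pm(u))$ and $E^\pm(u)$ upper unitriangular, and, with $f_i^{\pm}(u)=F^\pm(u)_{i+1,i}$ and $e_i^{\pm}(u)=E^\pm(u)_{i,i+1}$, there are unique elements $f_i^{(\pm r)},e_i^{(\pm r)}$ ($1\le i\le N-1$) and $d_j^{(\pm r)}$ ($1\le j\le N$), $r\ge 1$, of ${\rm DY}(\mathfrak{gl}_{m|n})$ such that $$f_i^-(u)=h\sum_{r\ge1}f_i^{(r)}u^{-r},\quad e_i^-(u)=h\sum_{r\ge1}e_i^{(r)}u^{-r},\quad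 d_j^-(u)=1+h\sum_{r\ge1}d_j^{(r)}u^{-r},$$ $$f_i^+(u)=-h\sum_{r\ge1}f_i^{(-r)}u^{r-1},\quad e_i^+(u)=-h\sum_{r\ge1}e_i^{(-r)}u^{r-1},\quad d_j^+(u)=1-h\sum_{r\ge1}d_j^{(-r)}u^{r-1}.$$ These elements $f_i^{(\pm r)}$, $e_i^{(\pm r)}$, $d_j^{(\pm r)}$ topologically generate ${\rm DY}(\mathfrak{gl}_{m|n})$: the unital $\mathbb C[[h]]$-subalgebra they generate is dense in ${\rm DY}(\mathfrak{gl}_{m|n})$ for the $h$-adic topology. (In $[[u^{\pm1}]]$ the sign is that of the superscript: $[[u^{-1}]]$ for $T^-$ and $[[u]]$ for $T^+$.) -/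

import Mathlib

namespace DoubleYangian

noncomputable section

/-- The deformation parameter `h` in the base ring `ℂ⟦h⟧`. -/
def h : PowerSeries ℂ := PowerSeries.X

/-- The generators of the double Yangian (`N = m + n`, indices counted from `0`):
`pos i j s` stands for `t_{ij}^{(s+1)}` and `neg i j s` stands for `t_{ij}^{(-(s+1))}`, `s ≥ 0`. -/
inductive Gen (N : ℕ) : Type
  | pos (i j : Fin N) (s : ℕ) : Gen N
  | neg (i j : Fin N) (s : ℕ) : Gen N

/-- The parity of an index: even for the first `m` indices, odd for the remaining `n`. -/
def par {m n : ℕ} (i : Fin (m + n)) : ℕ := if (i : ℕ) < m then 0 else 1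

/-- The parity `ī + j̄` (read modulo `2`) of the generators `t_{ij}^{(±r)}`. -/
def genPar {m n : ℕ} : Gen (m + n) → ℕ
  | .pos i j _ => par i + par j
  | .neg i j _ => par i + par j

/-- The free unital associative `ℂ⟦h⟧`-algebra on the generators `t_{ij}^{(±r)}`. -/
abbrev Free (m n : ℕ) : Type := FreeAlgebra (PowerSeries ℂ) (Gen (m + n))

/-- The parity automorphism `x ↦ (-1)^{|x|} x`, which encodes the `ℤ/2`-grading of the free
superalgebra in which `t_{ij}^{(±r)}` has parity `ī + j̄`. -/
def parityAut (m n : ℕ) : Free m n →ₐ[PowerSeries ℂ] Free m n :=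
  FreeAlgebra.lift (PowerSeries ℂ)
    fun g => (-1 : PowerSeries ℂ) ^ genPar g • FreeAlgebra.ι (PowerSeries ℂ) g

/-- The two families of generating series. -/
inductive Branch : Type
  | minus : Branch
  | plus : Branch

/-- The coefficient at `u ^ a`, `a ∈ ℤ`, of the series
`t⁻_{ij}(u) = δ_{ij} + h ∑_{r ≥ 1} t_{ij}^{(r)} u^{-r}` and
`t⁺_{ij}(u) = δ_{ij} - h ∑_{r ≥ 1} t_{ij}^{(-r)} u^{r-1}`. -/
def tCoeff {m n : ℕ} (i j : Fin (m + n)) : Branch → ℤ → Free m n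
  | .minus, .ofNat a => if i = j ∧ a = 0 then 1 else 0
  | .minus, .negSucc s => h • FreeAlgebra.ι (PowerSeries ℂ) (Gen.pos i j s)
  | .plus, .ofNat a =>
      (if i = j ∧ a = 0 then 1 else 0) - h • FreeAlgebra.ι (PowerSeries ℂ) (Gen.neg i j a)
  | .plus, .negSucc _ => 0

/-- Elements of `End ℂ^{m|n} ⊗ End ℂ^{m|n} ⊗ A`, where `A` is the free superalgebra:
`X i j k l ∈ A` is the coefficient of `e_{ij} ⊗ e_{kl}`, so that
`X = ∑ e_{ij} ⊗ e_{kl} ⊗ X i j k l`. -/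
abbrev Tensor (m n : ℕ) : Type :=
  Fin (m + n) → Fin (m + n) → Fin (m + n) → Fin (m + n) → Free m n

/-- The product of the superalgebra `End ⊗ End ⊗ A`. By the sign rule
`(x ⊗ y)(x' ⊗ y') = (-1)^{|y||x'|} xx' ⊗ yy'`, one has
`(e_{ij} ⊗ e_{kl} ⊗ a)(e_{jq} ⊗ e_{ls} ⊗ b)
  = (-1)^{(k̄+l̄)(j̄+q̄) + |a|(j̄+q̄+l̄+s̄)} e_{iq} ⊗ e_{ks} ⊗ ab`. -/
def superMul {m n : ℕ} (X Y : Tensor m n) : Tensor m n := fun i q k s =>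
  ∑ j, ∑ l, (-1 : PowerSeries ℂ) ^ ((par k + par l) * (par j + par q)) •
    ((parityAut m n)^[par j + par q + par l + par s] (X i j k l) * Y j q l s)

/-- `P = ∑_{i,j} (-1)^{j̄} e_{ij} ⊗ e_{ji} ⊗ 1`. -/
def permP (m n : ℕ) : Tensor m n := fun i j k l =>
  if k = j ∧ l = i then (-1) ^ par j else 0

/-- The coefficient at `u ^ a` of `T_1(u) = ∑ (-1)^{īj̄+j̄} e_{ij} ⊗ 1 ⊗ t_{ij}(u)`. -/
def T1 {m n : ℕ} (b : Branch) (a : ℤ) : Tensor m n := fun i j k l =>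
  if k = l then (-1 : PowerSeries ℂ) ^ (par i * par j + par j) • tCoeff i j b a else 0

/-- The coefficient at `u ^ a` of `T_2(u) = ∑ (-1)^{k̄l̄+l̄} 1 ⊗ e_{kl} ⊗ t_{kl}(u)`. -/
def T2 {m n : ℕ} (b : Branch) (a : ℤ) : Tensor m n := fun i j k l =>
  if i = j then (-1 : PowerSeries ℂ) ^ (par k * par l + par l) • tCoeff k l b a else 0

/-- The coefficient at `u ^ a v ^ c` of
`(u - v) (R(u-v) T_1(u) T_2(v) - T_2(v) T_1(u) R(u-v))`, where `R(u) = 1 - h P u⁻¹`, so that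
`(u - v) R(u-v) = (u - v) - h P`. The series `T_1` and `T_2` are of type `b₁` and `b₂`. -/
def rttDefect {m n : ℕ} (b₁ b₂ : Branch) (a c : ℤ) : Tensor m n :=
  (superMul (T1 b₁ (a - 1)) (T2 b₂ c) - superMul (T1 b₁ a) (T2 b₂ (c - 1))
      - h • superMul (permP m n) (superMul (T1 b₁ a) (T2 b₂ c)))
    - (superMul (T2 b₂ c) (T1 b₁ (a - 1)) - superMul (T2 b₂ (c - 1)) (T1 b₁ a)
      - h • superMul (superMul (T2 b₂ c) (T1 b₁ a)) (permP m n))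

/-- The defining relators: all coefficients of the `RTT`-relations for the pairs
`(T⁻, T⁻)`, `(T⁺, T⁺)` and `(T⁻, T⁺)`. -/
def relators (m n : ℕ) : Set (Free m n) :=
  {x | ∃ (b₁ b₂ : Branch) (a c : ℤ) (i j k l : Fin (m + n)),
    ¬(b₁ = .plus ∧ b₂ = .minus) ∧ x = rttDefect b₁ b₂ a c i j k l}

/-- The two-sided ideal of all `x` such that `h ^ p x` is in the ideal generated by the relators
for some `p`, i.e. the smallest two-sided ideal which contains the relators and has an
`h`-torsion free quotient (algebras over `ℂ⟦h⟧` are topologically free). -/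
def satIdeal (m n : ℕ) : TwoSidedIdeal (Free m n) :=
  TwoSidedIdeal.mk' {x | ∃ p : ℕ, h ^ p • x ∈ TwoSidedIdeal.span (relators m n)}
    ⟨0, by rw [smul_zero]; exact zero_mem _⟩
    (by
      rintro x y ⟨p, hp⟩ ⟨q, hq⟩
      refine ⟨p + q, ?_⟩
      have e : h ^ (p + q) • (x + y)
          = algebraMap _ (Free m n) (h ^ q) * (h ^ p • x)
            + algebraMap _ (Free m n) (h ^ p) * (h ^ q • y) := by
        rw [← Algebra.smul_def, ← Algebra.smul_def, smul_smul, smul_smul, ← pow_add, ← pow_add,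
          add_comm q p, smul_add]
      rw [e]
      exact add_mem (TwoSidedIdeal.mul_mem_left _ _ _ hp) (TwoSidedIdeal.mul_mem_left _ _ _ hq))
    (by
      rintro x ⟨p, hp⟩
      exact ⟨p, by rw [smul_neg]; exact neg_mem hp⟩)
    (by
      rintro x y ⟨p, hp⟩
      exact ⟨p, by rw [← mul_smul_comm]; exact TwoSidedIdeal.mul_mem_left _ _ _ hp⟩)
    (by
      rintro x y ⟨p, hp⟩
      exact ⟨p, by rw [← smul_mul_assoc]; exact TwoSidedIdeal.mul_mem_right _ _ _ hp⟩)

/-- The two-sided ideal `satIdeal + h ^ k • Free`. -/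
def levelIdeal (m n k : ℕ) : TwoSidedIdeal (Free m n) :=
  TwoSidedIdeal.mk' {x | ∃ y, x - h ^ k • y ∈ satIdeal m n}
    ⟨0, by rw [smul_zero, sub_zero]; exact zero_mem _⟩
    (by
      rintro x x' ⟨y, hy⟩ ⟨y', hy'⟩
      refine ⟨y + y', ?_⟩
      have e : x + x' - h ^ k • (y + y') = (x - h ^ k • y) + (x' - h ^ k • y') := by
        rw [smul_add]; abel
      rw [e]
      exact add_mem hy hy')
    (by
      rintro x ⟨y, hy⟩
      refine ⟨-y, ?_⟩
      have e : -x - h ^ k • (-y) = -(x - h ^ k • y) := by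
        rw [smul_neg]; abel
      rw [e]
      exact neg_mem hy)
    (by
      rintro z x ⟨y, hy⟩
      refine ⟨z * y, ?_⟩
      rw [← mul_smul_comm, ← mul_sub]
      exact TwoSidedIdeal.mul_mem_left _ _ _ hy)
    (by
      rintro x z ⟨y, hy⟩
      refine ⟨y * z, ?_⟩
      rw [← smul_mul_assoc, ← sub_mul]
      exact TwoSidedIdeal.mul_mem_right _ _ _ hy)

theorem levelIdeal_succ_le (m n k : ℕ) :
    (levelIdeal m n (k + 1)).ringCon ≤ (levelIdeal m n k).ringCon := by
  rw [← TwoSidedIdeal.ringCon_le_iff]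
  intro x hx
  obtain ⟨y, hy⟩ := (TwoSidedIdeal.mem_mk' _ _ _ _ _ _ _).1 hx
  refine (TwoSidedIdeal.mem_mk' _ _ _ _ _ _ _).2 ⟨h • y, ?_⟩
  rwa [smul_smul, ← pow_succ]

/-- The quotient `A / h ^ k A` of the algebra `A = Free / satIdeal`. -/
abbrev Level (m n k : ℕ) : Type := (levelIdeal m n k).ringCon.Quotient

/-- The projection `A / h ^ (k+1) A → A / h ^ k A`. -/
def transition (m n k : ℕ) : Level m n (k + 1) →ₐ[PowerSeries ℂ] Level m n k :=
  RingCon.factorₐ (PowerSeries ℂ) (levelIdeal_succ_le m n k)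

/-- The inverse limit of the `A / h ^ k A`. -/
def limitSubalgebra (m n : ℕ) : Subalgebra (PowerSeries ℂ) (∀ k, Level m n k) where
  carrier := {x | ∀ k, transition m n k (x (k + 1)) = x k}
  mul_mem' := by
    intro x y hx hy k
    rw [Pi.mul_apply, Pi.mul_apply, map_mul, hx k, hy k]
  add_mem' := by
    intro x y hx hy k
    rw [Pi.add_apply, Pi.add_apply, map_add, hx k, hy k]
  algebraMap_mem' := by
    intro r k
    rw [Pi.algebraMap_apply, Pi.algebraMap_apply, AlgHom.commutes]

/-- The double Yangian `DY(gl_{m|n})`: the `h`-adic completion of the algebra `Free / satIdeal`. -/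
abbrev DY (m n : ℕ) : Type := limitSubalgebra m n

/-- The canonical homomorphism from the free algebra to the double Yangian. -/
def toDY (m n : ℕ) : Free m n →ₐ[PowerSeries ℂ] DY m n :=
  AlgHom.codRestrict
    (AlgHom.pi fun k => (levelIdeal m n k).ringCon.mkₐ (PowerSeries ℂ))
    (limitSubalgebra m n)
    (fun _ k => RingCon.factorₐ_mk (R := PowerSeries ℂ) (levelIdeal_succ_le m n k) _)

/-- The matrix `(t⁻_{ij}(u))`, with entries in `DY⟦u⁻¹⟧`: the variable of the power series
is `u⁻¹`. -/
def Tminus (m n : ℕ) : Matrix (Fin (m + n)) (Fin (m + n)) (PowerSeries (DY m n)) :=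
  fun i j => PowerSeries.mk fun s => toDY m n (tCoeff i j .minus (-(s : ℤ)))

/-- The matrix `(t⁺_{ij}(u))`, with entries in `DY⟦u⟧`. -/
def Tplus (m n : ℕ) : Matrix (Fin (m + n)) (Fin (m + n)) (PowerSeries (DY m n)) :=
  fun i j => PowerSeries.mk fun s => toDY m n (tCoeff i j .plus (s : ℤ))

/-- Gauss decompositions `T = F D E` of a square matrix `T` over a ring, with `F` lower
unitriangular, `D` diagonal and `E` upper unitriangular. -/
@[ext] structure GaussDecomposition {N : ℕ} {S : Type} [Ring S] (T : Matrix (Fin N) (Fin N) S) where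
  F : Matrix (Fin N) (Fin N) S
  D : Matrix (Fin N) (Fin N) S
  E : Matrix (Fin N) (Fin N) S
  F_diag : ∀ i, F i i = 1
  F_upper : ∀ i j, i < j → F i j = 0
  D_diag : D.IsDiag
  E_diag : ∀ i, E i i = 1
  E_lower : ∀ i j, j < i → E i j = 0
  eq : T = F * D * E

/-- For `i ∈ {0, …, N - 2}`, the index `i` among `{0, …, N - 1}`. -/
def lo {N : ℕ} (i : Fin (N - 1)) : Fin N := ⟨i, by omega⟩

/-- For `i ∈ {0, …, N - 2}`, the index `i + 1` among `{0, …, N - 1}`. -/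
def hi {N : ℕ} (i : Fin (N - 1)) : Fin N := ⟨i + 1, by omega⟩

/-- The Gauss decompositions of `T⁻(u)` and `T⁺(u)` together with the coefficients of the series
`f_i^±(u) = f_{i+1,i}^±(u)`, `e_i^±(u) = e_{i,i+1}^±(u)` and `d_j^±(u)`, normalized by
`f_i⁻(u) = h ∑_{r≥1} f_i^{(r)} u^{-r}`,   `f_i⁺(u) = -h ∑_{r≥1} f_i^{(-r)} u^{r-1}`,
`e_i⁻(u) = h ∑_{r≥1} e_i^{(r)} u^{-r}`,   `e_i⁺(u) = -h ∑_{r≥1} e_i^{(-r)} u^{r-1}`,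
`d_j⁻(u) = 1 + h ∑_{r≥1} d_j^{(r)} u^{-r}`,   `d_j⁺(u) = 1 - h ∑_{r≥1} d_j^{(-r)} u^{r-1}`.
Here `fPos i s` is `f_i^{(s+1)}`, `fNeg i s` is `f_i^{(-(s+1))}` for `s ≥ 0`, etc. -/
@[ext] structure DrinfeldData (m n : ℕ) where
  gaussMinus : GaussDecomposition (Tminus m n)
  gaussPlus : GaussDecomposition (Tplus m n)
  fPos : Fin (m + n - 1) → ℕ → DY m n
  fNeg : Fin (m + n - 1) → ℕ → DY m n
  ePos : Fin (m + n - 1) → ℕ → DY m n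
  eNeg : Fin (m + n - 1) → ℕ → DY m n
  dPos : Fin (m + n) → ℕ → DY m n
  dNeg : Fin (m + n) → ℕ → DY m n
  fPos_eq : ∀ i, gaussMinus.F (hi i) (lo i) =
    PowerSeries.X * PowerSeries.mk fun s => h • fPos i s
  ePos_eq : ∀ i, gaussMinus.E (lo i) (hi i) =
    PowerSeries.X * PowerSeries.mk fun s => h • ePos i s
  dPos_eq : ∀ j, gaussMinus.D j j =
    1 + PowerSeries.X * PowerSeries.mk fun s => h • dPos j s
  fNeg_eq : ∀ i, gaussPlus.F (hi i) (lo i) = -PowerSeries.mk fun s => h • fNeg i s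
  eNeg_eq : ∀ i, gaussPlus.E (lo i) (hi i) = -PowerSeries.mk fun s => h • eNeg i s
  dNeg_eq : ∀ j, gaussPlus.D j j = 1 - PowerSeries.mk fun s => h • dNeg j s

/-- The set of all `f_i^{(±r)}`, `e_i^{(±r)}`, `d_j^{(±r)}`. -/
def DrinfeldData.coefficients {m n : ℕ} (G : DrinfeldData m n) : Set (DY m n) :=
  {x | (∃ i s, x = G.fPos i s ∨ x = G.fNeg i s ∨ x = G.ePos i s ∨ x = G.eNeg i s) ∨
    ∃ j s, x = G.dPos j s ∨ x = G.dNeg j s}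

/-- `S` topologically generates the `ℂ⟦h⟧`-algebra `A`: the unital subalgebra generated by `S` is
dense in the `h`-adic topology. -/
def TopologicallyGenerates {A : Type} [Ring A] [Algebra (PowerSeries ℂ) A] (S : Set A) : Prop :=
  @Dense A ((Ideal.span {h}).adicModuleTopology A) (Algebra.adjoin (PowerSeries ℂ) S : Set A)

end

end DoubleYangian

/-! Both matrices have the form `T = 1 + z T'` with `z` central and regular and every `1 + z s`
invertible: `z = h u⁻¹` for `T⁻`, and `z = h` for `T⁺`, where invertibility rests on `h`-adic
completeness. Schur complements then produce a Gauss decomposition whose factors are again of the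
form `1 + z (·)` (`exists_gauss_factors`). It is unique because its diagonal entries are units, and
the normalized coefficients are unique because the double Yangian has no `h`-torsion.

For generation, let `A` be the subalgebra generated by the coefficients. At first order in `u⁻¹`,
`t_{i,i+1}^{(1)} = e_i^{(1)}` and `t_{i+1,i}^{(1)} = f_i^{(1)}`, so these elements lie in `A`. The
coefficient of `u^0` in the relation between `T⁻(u)` and `T^±(v)` says that supercommutation with
`t_{iq}^{(1)}` is, up to signs, an elementary row operation minus an elementary column operation on
`T^±(v)` (`supercommutator_first`). For `q = i + 1`, only the column operation is visible on the
rows above `i`, and there it passes to the upper triangular factor (`intertwine`,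
`GaussDecomposition.upper_intertwine`): the supercommutator with the entry `(a, i)` is, up to sign,
the entry `(a, i + 1)`. So each row of `E` is recovered column by column from its entry next to the
diagonal. The factor `F` follows by transposition over the opposite ring. Multiplying the factors
puts every `t_{ij}^{(±r)}` into `A`, hence also the image of the free algebra, which is dense
(`Tmatrix_mem`, `topologicallyGenerates_of_generators`). -/

namespace DoubleYangian

/-! ### Gauss decompositions over a noncommutative ring -/

/-- If `G (U E) = (U' E') L` in the rows `< J`, where `G` is diagonal and `L` agrees with `G` in the
columns `< J`, then the triangular factors are intertwined separately in these rows. -/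
theorem intertwine {N : ℕ} {S : Type} [Ring S] {U U' E E' L : Matrix (Fin N) (Fin N) S}
    (G : Fin N → S) (J : ℕ)
    (hU : ∀ i j, i < j → U i j = 0) (hU' : ∀ i j, i < j → U' i j = 0)
    (hE : ∀ i, E i i = 1) (hE0 : ∀ i j, j < i → E i j = 0)
    (hE' : ∀ i, E' i i = 1) (hE'0 : ∀ i j, j < i → E' i j = 0)
    (hL : ∀ a b : Fin N, (b : ℕ) < J → L a b = if a = b then G b else 0)
    (hreg : ∀ i x, U' i i * x = 0 → x = 0)
    (hT : ∀ a b : Fin N, (a : ℕ) < J → G a * (U * E) a b = (U' * (E' * L)) a b)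
    (i : Fin N) (hi : (i : ℕ) < J) :
    (∀ b, b ≤ i → G i * U i b = U' i b * G b) ∧ ∀ b, G i * E i b = (E' * L) i b := by
  have hV : ∀ a b : Fin N, (b : ℕ) < J → (E' * L) a b = E' a b * G b := by
    intro a b hb
    rw [Matrix.mul_apply, Finset.sum_eq_single b]
    · rw [hL b b hb, if_pos rfl]
    · intro c _ hc
      rw [hL c b hb, if_neg hc, mul_zero]
    · simp
  have hT' : ∀ a b : Fin N, (a : ℕ) < J →
      ∑ c, (G a * U a c * E c b - U' a c * (E' * L) c b) = 0 := by
    intro a b ha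
    have := hT a b ha
    rw [Matrix.mul_apply, Matrix.mul_apply, Finset.mul_sum] at this
    rw [Finset.sum_sub_distrib, sub_eq_zero, ← this]
    exact Finset.sum_congr rfl fun c _ => mul_assoc _ _ _
  induction i using WellFoundedLT.induction with
  | ind i IH =>
    -- In entry `(i, b)` the terms with `c < b` cancel by the two inductions, and those with `c > b`
    -- vanish by triangularity of `E` and `E'`; only `c = b` is left.
    have h1 : ∀ b, b ≤ i → G i * U i b = U' i b * G b := by
      intro b
      induction b using WellFoundedLT.induction with
      | ind b IHb =>
        intro hbi
        have hbJ : (b : ℕ) < J := lt_of_le_of_lt hbi hi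
        have := hT' i b hi
        rw [Finset.sum_eq_single b] at this
        · rwa [hE, hV b b hbJ, hE', one_mul, mul_one, sub_eq_zero] at this
        · intro c _ hc
          rcases lt_or_gt_of_ne hc with hc | hc
          · have hci := lt_of_lt_of_le hc hbi
            rw [IHb c hc hci.le, mul_assoc, (IH c hci (lt_trans hci hi)).2, sub_self]
          · rw [hE0 c b hc, hV c b hbJ, hE'0 c b hc, mul_zero, zero_mul, mul_zero, sub_zero]
        · simp
    refine ⟨h1, fun b => ?_⟩
    -- With `h1` known, the terms `c < i` cancel for every column `b`, and those with `c > i` vanish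
    -- by triangularity of `U` and `U'`. The surviving term is `U' i i` times the desired
    -- difference.
    have := hT' i b hi
    rw [Finset.sum_eq_single i] at this
    · rw [h1 i le_rfl, mul_assoc, ← mul_sub] at this
      exact sub_eq_zero.1 (hreg i _ this)
    · intro c _ hc
      rcases lt_or_gt_of_ne hc with hc | hc
      · rw [h1 c hc.le, mul_assoc, (IH c hc (lt_trans hc hi)).2, sub_self]
      · rw [hU i c hc, hU' i c hc, mul_zero, zero_mul, zero_mul, sub_zero]
    · simp

/-- Invertibility of `D` makes Gauss decompositions unique. -/
theorem GaussDecomposition.eq_of_regular {N : ℕ} {S : Type} [Ring S]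
    {T : Matrix (Fin N) (Fin N) S} (g g' : GaussDecomposition T)
    (hd : ∀ i, IsUnit (g.D i i)) : g' = g := by
  have hFD : ∀ (k : GaussDecomposition T) i j, (k.F * k.D) i j = k.F i j * k.D j j := by
    intro k i j
    rw [Matrix.mul_apply, Finset.sum_eq_single j]
    · intro c _ hc
      rw [k.D_diag hc, mul_zero]
    · simp
  -- With `G = L = 1` and all rows allowed, intertwining compares the two factorizations `(F D) E`
  -- of `T`.
  have key := intertwine (U := g'.F * g'.D) (U' := g.F * g.D) (E := g'.E) (E' := g.E) (L := 1)
    (fun _ => 1) N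
    (fun i j hij => by rw [hFD, g'.F_upper i j hij, zero_mul])
    (fun i j hij => by rw [hFD, g.F_upper i j hij, zero_mul])
    g'.E_diag g'.E_lower g.E_diag g.E_lower
    (fun a b _ => Matrix.one_apply)
    (fun i x hx => by
      rw [hFD, g.F_diag, one_mul] at hx
      exact (hd i).mul_right_eq_zero.1 hx)
    (fun a b _ => by rw [← g'.eq, mul_one, ← g.eq, one_mul])
  have hE : g'.E = g.E := by
    ext i j
    simpa using (key i i.2).2 j
  have hU : ∀ i j, j ≤ i → g'.F i j * g'.D j j = g.F i j * g.D j j := by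
    intro i j hij
    simpa [hFD] using (key i i.2).1 j hij
  have hDd : ∀ i, g'.D i i = g.D i i := by
    intro i
    simpa [g.F_diag, g'.F_diag] using hU i i le_rfl
  have hF : g'.F = g.F := by
    ext i j
    rcases lt_or_ge i j with hij | hij
    · rw [g.F_upper i j hij, g'.F_upper i j hij]
    · have := hU i j hij
      rw [hDd] at this
      exact (hd j).mul_left_injective this
  have hD : g'.D = g.D := by
    ext i j
    by_cases hij : i = j
    · rw [hij, hDd]
    · rw [g.D_diag hij, g'.D_diag hij]
  exact GaussDecomposition.ext hF hD hE

/-- Gauss decompositions of matrices `1 + z T`, in coordinates. -/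
theorem exists_gauss_factors {S : Type} [Ring S] (z : S) (hz : ∀ s, Commute z s)
    (hu : ∀ s, IsUnit (1 + z * s)) :
    ∀ (N : ℕ) (T : Matrix (Fin N) (Fin N) S),
      ∃ (F : Matrix (Fin N) (Fin N) S) (d : Fin N → S) (E : Matrix (Fin N) (Fin N) S),
        (∀ i j, i ≤ j → F i j = 0) ∧ (∀ i j, j ≤ i → E i j = 0) ∧
        1 + z • T = (1 + z • F) * (1 + z • Matrix.diagonal d) * (1 + z • E) := by
  intro N
  induction N with
  | zero => exact fun T => ⟨0, 0, 0, fun i => i.elim0, fun i => i.elim0, by ext i; exact i.elim0⟩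
  | succ N ih =>
    intro T
    obtain ⟨w, hw⟩ := hu (T 0 0)
    -- The Schur complement of the corner `w = 1 + z * T 0 0` in `1 + z T` is `1 + z (·)` of this
    -- matrix, since `z` is central.
    obtain ⟨F, d, E, hF, hE, h⟩ := ih (Matrix.of fun i j =>
      T i.succ j.succ - z * (T i.succ 0 * ↑w⁻¹ * T 0 j.succ))
    refine ⟨Matrix.of fun i j => Fin.cases 0 (fun i => Fin.cases (T i.succ 0 * ↑w⁻¹) (F i) j) i,
      Fin.cons (T 0 0) d,
      Matrix.of fun i j => Fin.cases (Fin.cases 0 (fun j => ↑w⁻¹ * T 0 j.succ) j)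
        (fun i => Fin.cases 0 (E i) j) i, ?_, ?_, ?_⟩
    · intro i j hij
      refine Fin.cases (by simp) (fun i hij => ?_) i hij
      refine Fin.cases (by simp) (fun j hij => ?_) j hij
      simpa using hF i j (by simpa using hij)
    · intro i j hij
      refine Fin.cases (fun hij => ?_) (fun i hij => ?_) i hij
      · have : j = 0 := by simpa using hij
        simp [this]
      · refine Fin.cases (by simp) (fun j hij => ?_) j hij
        simpa using hE i j (by simpa using hij)
    · have hcoord : ∀ (n : ℕ) (A B C : Matrix (Fin n) (Fin n) S) (i j : Fin n)
        (δ : Fin n → S), B = Matrix.diagonal δ →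
        (A * B * C) i j = ∑ k, A i k * δ k * C k j := by
        rintro n A B C i j δ rfl
        rw [Matrix.mul_apply]
        simp [Matrix.mul_diagonal]
      have hdiag : ∀ (n : ℕ) (δ : Fin n → S), 1 + z • Matrix.diagonal δ =
          Matrix.diagonal fun k => 1 + z * δ k := by
        intro n δ
        rw [← Matrix.diagonal_one, ← Matrix.diagonal_smul, Matrix.diagonal_add]
        rfl
      have h' := fun i j => congrFun (congrFun h i) j
      simp only [hcoord _ _ _ _ _ _ _ (hdiag _ _), Matrix.add_apply, Matrix.smul_apply,
        smul_eq_mul, Matrix.of_apply] at h'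
      have e1 : (1 + z * T 0 0) * ↑w⁻¹ = 1 := by rw [← hw]; simp
      have e2 : ↑w⁻¹ * (1 + z * T 0 0) = 1 := by rw [← hw]; simp
      ext i j
      rw [hcoord _ _ _ _ _ _ _ (hdiag _ _), Fin.sum_univ_succ]
      simp only [Matrix.add_apply, Matrix.smul_apply, smul_eq_mul, Matrix.of_apply]
      refine Fin.cases ?_ (fun i => ?_) i <;> refine Fin.cases ?_ (fun j => ?_) j
      · simp
      · have := (hz (1 + z * T 0 0)).eq
        simp only [Fin.cases_zero, Fin.cases_succ, Fin.cons_zero, Fin.cons_succ,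
          Matrix.one_apply_eq, mul_zero, add_zero, one_mul, zero_mul, Finset.sum_const_zero,
          Matrix.one_apply_ne (Fin.succ_ne_zero _).symm, zero_add]
        rw [← mul_assoc, ← this, mul_assoc, ← mul_assoc _ (↑w⁻¹ : S), e1, one_mul]
      · simp only [Fin.cases_zero, Fin.cases_succ, Fin.cons_zero, Fin.cons_succ,
          Matrix.one_apply_eq, mul_zero, add_zero, mul_one, Finset.sum_const_zero,
          Matrix.one_apply_ne (Fin.succ_ne_zero _), zero_add]
        rw [mul_assoc, mul_assoc, e2, mul_one]
      · have e3 : z * (T i.succ 0 * ↑w⁻¹) * (1 + z * T 0 0) * (z * (↑w⁻¹ * T 0 j.succ)) =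
            z * (z * (T i.succ 0 * ↑w⁻¹ * T 0 j.succ)) := by
          rw [mul_assoc z, mul_assoc (T i.succ 0), e2, mul_one, mul_assoc z,
            ← mul_assoc (T i.succ 0) z, ← (hz (T i.succ 0)).eq]
          simp only [mul_assoc]
        have hij : (1 : Matrix (Fin (N + 1)) (Fin (N + 1)) S) i.succ j.succ
            = (1 : Matrix (Fin N) (Fin N) S) i j := by
          simp [Matrix.one_apply]
        have h2 : ∀ k : Fin N, (1 : Matrix (Fin (N + 1)) (Fin (N + 1)) S) i.succ k.succ
            = (1 : Matrix (Fin N) (Fin N) S) i k := fun k => by simp [Matrix.one_apply]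
        have h3 : ∀ k : Fin N, (1 : Matrix (Fin (N + 1)) (Fin (N + 1)) S) k.succ j.succ
            = (1 : Matrix (Fin N) (Fin N) S) k j := fun k => by simp [Matrix.one_apply]
        simp only [Fin.cases_zero, Fin.cases_succ, Fin.cons_zero, Fin.cons_succ, hij, h2, h3,
          Matrix.one_apply_ne (Fin.succ_ne_zero _), Matrix.one_apply_ne (Fin.succ_ne_zero _).symm,
          zero_add]
        rw [e3, ← h' i j, mul_sub]
        abel

/-! ### The completed algebra: torsion, divisibility by `h`, units, density -/

theorem mem_satIdeal_of_h_pow_smul {m n : ℕ} (k : ℕ) {x : Free m n}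
    (hx : h ^ k • x ∈ satIdeal m n) : x ∈ satIdeal m n := by
  obtain ⟨p, hp⟩ := (TwoSidedIdeal.mem_mk' _ _ _ _ _ _ _).1 hx
  refine (TwoSidedIdeal.mem_mk' _ _ _ _ _ _ _).2 ⟨p + k, ?_⟩
  rwa [pow_add, ← smul_smul]

theorem mem_levelIdeal {m n k : ℕ} {x : Free m n} :
    x ∈ levelIdeal m n k ↔ ∃ y, x - h ^ k • y ∈ satIdeal m n :=
  TwoSidedIdeal.mem_mk' _ _ _ _ _ _ _

/-- The projection of the free algebra to `A / h ^ k A`. -/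
noncomputable def toLevel (m n k : ℕ) : Free m n →ₐ[PowerSeries ℂ] Level m n k :=
  (levelIdeal m n k).ringCon.mkₐ (PowerSeries ℂ)

theorem toLevel_surjective (m n k : ℕ) : Function.Surjective (toLevel m n k) :=
  RingCon.mkₐ_surjective _

theorem toLevel_eq_iff {m n k : ℕ} {x y : Free m n} :
    toLevel m n k x = toLevel m n k y ↔ x - y ∈ levelIdeal m n k :=
  (RingCon.eq _).trans (TwoSidedIdeal.rel_iff _ _ _)

theorem toLevel_eq_zero_iff {m n k : ℕ} {x : Free m n} :
    toLevel m n k x = 0 ↔ x ∈ levelIdeal m n k := by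
  rw [← map_zero (toLevel m n k), toLevel_eq_iff, sub_zero]

theorem transition_toLevel {m n k : ℕ} (x : Free m n) :
    transition m n k (toLevel m n (k + 1) x) = toLevel m n k x :=
  RingCon.factorₐ_mk (R := PowerSeries ℂ) (levelIdeal_succ_le m n k) _

theorem toDY_apply {m n : ℕ} (x : Free m n) (k : ℕ) : (toDY m n x).1 k = toLevel m n k x := rfl

theorem h_pow_smul_level {m n k : ℕ} (x : Level m n k) : h ^ k • x = 0 := by
  obtain ⟨a, rfl⟩ := toLevel_surjective m n k x
  rw [← map_smul, toLevel_eq_zero_iff, mem_levelIdeal]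
  exact ⟨a, by rw [sub_self]; exact zero_mem _⟩

theorem toDY_eq_zero {m n : ℕ} {x : Free m n} (hx : x ∈ satIdeal m n) : toDY m n x = 0 := by
  apply Subtype.ext
  funext k
  rw [toDY_apply]
  refine toLevel_eq_zero_iff.2 (mem_levelIdeal.2 ⟨0, ?_⟩)
  rwa [smul_zero, sub_zero]

/-- A family of lifts of the components of an element of the inverse limit. -/
theorem exists_lifts {m n : ℕ} (x : DY m n) : ∃ a : ℕ → Free m n,
    (∀ k, toLevel m n k (a k) = x.1 k) ∧ ∀ k, a (k + 1) - a k ∈ levelIdeal m n k := by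
  choose a ha using fun k => toLevel_surjective m n k (x.1 k)
  refine ⟨a, ha, fun k => ?_⟩
  rw [← toLevel_eq_iff, ha, ← transition_toLevel, ha]
  exact x.2 k

/-- Torsion at one finite level does not vanish, but it dies one level lower: `h a = h^(k+1) y`
modulo the saturated ideal gives `a = h^k y`, so the component at level `k` is zero. -/
theorem h_smul_eq_zero {m n : ℕ} {x : DY m n} (hx : h • x = 0) : x = 0 := by
  obtain ⟨a, ha, hs⟩ := exists_lifts x
  apply Subtype.ext
  funext k
  have h1 : h • x.1 (k + 1) = 0 := congrFun (congrArg Subtype.val hx) (k + 1)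
  rw [← ha, ← map_smul, toLevel_eq_zero_iff, mem_levelIdeal] at h1
  obtain ⟨y, hy⟩ := h1
  change x.1 k = 0
  rw [← x.2 k, ← ha, transition_toLevel, toLevel_eq_zero_iff, mem_levelIdeal]
  refine ⟨y, mem_satIdeal_of_h_pow_smul 1 ?_⟩
  rwa [pow_one, smul_sub, smul_smul, ← pow_succ']

/-- Lifts of the components at levels `k + l` are `h^k y_l` modulo the saturated ideal. Saturation
allows `h^k` to be cancelled in their differences, so the `y_l` are compatible and define the
quotient. -/
theorem exists_h_pow_smul {m n k : ℕ} {x : DY m n} (hx : x.1 k = 0) :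
    ∃ y : DY m n, x = h ^ k • y := by
  obtain ⟨a, ha, hs⟩ := exists_lifts x
  have hlow : ∀ l, toLevel m n k (a (k + l)) = 0 := by
    intro l
    induction l with
    | zero => rw [add_zero, ha, hx]
    | succ l ih =>
      rw [← ih, toLevel_eq_iff]
      obtain ⟨y, hy⟩ := mem_levelIdeal.1 (hs (k + l))
      exact mem_levelIdeal.2 ⟨h ^ l • y, by rwa [smul_smul, ← pow_add]⟩
  have hlow' := fun l => mem_levelIdeal.1 (toLevel_eq_zero_iff.1 (hlow l))
  choose y hy using hlow'
  refine ⟨⟨fun l => toLevel m n l (y l), fun l => ?_⟩, ?_⟩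
  · rw [transition_toLevel, toLevel_eq_iff, mem_levelIdeal]
    obtain ⟨w, hw⟩ := mem_levelIdeal.1 (hs (k + l))
    refine ⟨w, mem_satIdeal_of_h_pow_smul k ?_⟩
    have e : h ^ k • (y (l + 1) - y l - h ^ l • w) =
        (a (k + l + 1) - a (k + l) - h ^ (k + l) • w) - (a (k + (l + 1)) - h ^ k • y (l + 1))
          + (a (k + l) - h ^ k • y l) := by
      rw [smul_sub, smul_sub, smul_smul, ← pow_add, ← add_assoc]
      abel
    rw [e]
    exact add_mem (sub_mem hw (hy _)) (hy _)
  · apply Subtype.ext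
    funext l
    change x.1 l = h ^ k • toLevel m n l (y l)
    have hdesc : ∀ p, toLevel m n l (a (l + p)) = x.1 l := by
      intro p
      induction p with
      | zero => rw [add_zero, ha]
      | succ p ih =>
        rw [← ih, toLevel_eq_iff]
        obtain ⟨y, hy⟩ := mem_levelIdeal.1 (hs (l + p))
        exact mem_levelIdeal.2 ⟨h ^ p • y, by rwa [smul_smul, ← pow_add]⟩
    rw [← hdesc k, ← map_smul, toLevel_eq_iff, mem_levelIdeal, add_comm l k]
    exact ⟨0, by rw [smul_zero, sub_zero]; exact hy l⟩

/-- The inverse is the geometric series in `-h x`. At level `k` it may be cut off after `k` terms,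
because `h^k` is zero there. -/
theorem isUnit_one_add_h_smul {m n : ℕ} (x : DY m n) : IsUnit (1 + h • x) := by
  let y : ℕ → (∀ k, Level m n k) := fun N => ∑ i ∈ Finset.range N, (-(h • x.1)) ^ i
  have hpow : ∀ k, (-(h • x.1)) ^ k = (-1) ^ k * h ^ k • x.1 ^ k := by
    intro k
    rw [neg_pow, smul_pow]
  have hy : ∀ k, transition m n k (y (k + 1) (k + 1)) = y k k := by
    intro k
    have e : ∀ N, transition m n k (y N (k + 1)) = y N k := by
      intro N
      simp only [y, Finset.sum_apply, map_sum]
      refine Finset.sum_congr rfl fun i _ => ?_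
      rw [Pi.pow_apply, Pi.pow_apply, map_pow]
      congr 1
      change transition m n k (-(h • x.1 (k + 1))) = -(h • x.1 k)
      rw [map_neg, map_smul, x.2 k]
    rw [e]
    simp only [y, Finset.sum_range_succ, Pi.add_apply]
    rw [hpow, Pi.mul_apply, Pi.smul_apply, h_pow_smul_level, mul_zero, add_zero]
  have hzero : ∀ k, ((-(h • x.1)) ^ k : ∀ k, Level m n k) k = 0 := by
    intro k
    rw [hpow, Pi.mul_apply, Pi.smul_apply, h_pow_smul_level, mul_zero]
  let Y : DY m n := ⟨fun k => y k k, hy⟩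
  refine ⟨⟨1 + h • x, Y, ?_, ?_⟩, rfl⟩ <;>
  · apply Subtype.ext
    funext k
    first
    | change ((1 + h • x.1) * y k) k = 1
      have := congrFun (mul_neg_geom_sum (-(h • x.1)) k) k
      rw [sub_neg_eq_add, Pi.sub_apply, hzero, sub_zero] at this
      exact this
    | change (y k * (1 + h • x.1)) k = 1
      have := congrFun (geom_sum_mul_neg (-(h • x.1)) k) k
      rw [sub_neg_eq_add, Pi.sub_apply, hzero, sub_zero] at this
      exact this

/-- A subalgebra of the double Yangian that contains the image of the free algebra is dense. -/
theorem topologicallyGenerates_of_generators {m n : ℕ} {S : Set (DY m n)}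
    (hS : ∀ g : Gen (m + n), toDY m n (FreeAlgebra.ι _ g) ∈ Algebra.adjoin (PowerSeries ℂ) S) :
    TopologicallyGenerates S := by
  have hrange : ∀ a : Free m n, toDY m n a ∈ Algebra.adjoin (PowerSeries ℂ) S := by
    intro a
    induction a using FreeAlgebra.induction with
    | grade0 r => rw [AlgHom.commutes]; exact Subalgebra.algebraMap_mem _ r
    | grade1 g => exact hS g
    | mul a b ha hb => rw [map_mul]; exact mul_mem ha hb
    | add a b ha hb => rw [map_add]; exact add_mem ha hb
  intro x
  let I : Ideal (PowerSeries ℂ) := Ideal.span {h}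
  let := I.adicTopology
  let M := I.ringFilterBasis.moduleFilterBasis (I.adic_module_basis (DY m n))
  let := I.adicModuleTopology (DY m n)
  change x ∈ closure _
  rw [mem_closure_iff_nhds]
  intro t ht
  have hb := M.toAddGroupFilterBasis.nhds_hasBasis x
  obtain ⟨V, hV, hVt⟩ := hb.mem_iff.1 ht
  obtain ⟨k, rfl⟩ := hV
  -- A lift of the component at level `k` approximates `x` up to a multiple of `h^k`.
  obtain ⟨a, ha⟩ := toLevel_surjective m n k (x.1 k)
  obtain ⟨y, hy⟩ := exists_h_pow_smul (k := k) (x := toDY m n a - x)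
    (by change toLevel m n k a - x.1 k = 0; rw [ha, sub_self])
  refine ⟨toDY m n a, hVt ⟨h ^ k • y, ?_, ?_⟩, hrange a⟩
  · exact Submodule.smul_mem_smul (Ideal.pow_mem_pow (Ideal.mem_span_singleton_self h) k)
      Submodule.mem_top
  · change x + h ^ k • y = _
    rw [← hy]; abel

/-! ### Signs and the products in the `RTT` relation -/

theorem par_eq {m n : ℕ} (i : Fin (m + n)) : par i = 0 ∨ par i = 1 := by
  unfold par; split_ifs <;> simp

theorem neg_one_pow_congr_mod_two {A : Type*} [Ring A] {a b : ℕ} (hab : a % 2 = b % 2) :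
    (-1 : A) ^ a = (-1) ^ b := by
  rw [← Nat.div_add_mod a 2, ← Nat.div_add_mod b 2, hab]
  simp [pow_add, pow_mul]

theorem neg_one_pow_smul_eq_mul {K A : Type*} [CommRing K] [Ring A] [Algebra K A] (a : ℕ) (x : A) :
    (-1 : K) ^ a • x = (-1) ^ a * x := by
  rw [Algebra.smul_def, map_pow, map_neg, map_one]

theorem neg_one_pow_smul_eq_mul' {K A : Type*} [CommRing K] [Ring A] [Algebra K A] (a : ℕ) (x : A) :
    (-1 : K) ^ a • x = x * (-1) ^ a := by
  rw [neg_one_pow_smul_eq_mul, ((Commute.one_right x).neg_right.pow_right _).eq]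

theorem parityAut_tCoeff {m n : ℕ} (i j : Fin (m + n)) (b : Branch) (a : ℤ) :
    parityAut m n (tCoeff i j b a) = (-1 : PowerSeries ℂ) ^ (par i + par j) • tCoeff i j b a := by
  have hδ : parityAut m n (if i = j ∧ a = 0 then 1 else 0) =
      (-1 : PowerSeries ℂ) ^ (par i + par j) • (if i = j ∧ a = 0 then 1 else 0) := by
    split_ifs with hij
    · rw [hij.1, map_one, ← two_mul, pow_mul]
      simp
    · simp
  have hι : ∀ g, parityAut m n (FreeAlgebra.ι _ g) =
      (-1 : PowerSeries ℂ) ^ genPar g • FreeAlgebra.ι _ g := by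
    intro g
    exact FreeAlgebra.lift_ι_apply _ _
  rcases b with _ | _ <;> rcases a with a | a
  · simpa [tCoeff] using hδ
  · simp only [tCoeff, map_smul, hι, genPar, smul_comm h]
  · simp only [tCoeff, map_sub, map_smul, hι, genPar, smul_comm h, smul_sub]
    congr 1
    simpa using hδ
  · simp [tCoeff]

theorem parityAut_iterate_tCoeff {m n : ℕ} (i j : Fin (m + n)) (b : Branch) (a : ℤ) (p : ℕ) :
    (parityAut m n)^[p] (tCoeff i j b a) =
      (-1 : PowerSeries ℂ) ^ (p * (par i + par j)) • tCoeff i j b a := by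
  induction p with
  | zero => simp
  | succ p ih =>
    rw [Function.iterate_succ_apply', ih, map_smul, parityAut_tCoeff, smul_smul, ← pow_add]
    congr 2; ring

theorem parityAut_iterate_smul {m n : ℕ} (r : PowerSeries ℂ) (x : Free m n) (p : ℕ) :
    (parityAut m n)^[p] (r • x) = r • (parityAut m n)^[p] x := by
  induction p with
  | zero => rfl
  | succ p ih => rw [Function.iterate_succ_apply', ih, map_smul, Function.iterate_succ_apply']

theorem parityAut_iterate_neg_one_pow {m n : ℕ} (p k : ℕ) :
    (parityAut m n)^[p] ((-1) ^ k) = (-1) ^ k := by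
  induction p with
  | zero => rfl
  | succ p ih => rw [Function.iterate_succ_apply', ih, map_pow, map_neg, map_one]

/-- `T_1` and `T_2` are the identity in one tensor factor, so one term of the double sum survives;
its sign is checked on all parities. -/
theorem superMul_T1_T2 {m n : ℕ} (b b' : Branch) (a c : ℤ) (i q k s : Fin (m + n)) :
    superMul (T1 b a) (T2 b' c) i q k s =
      (-1 : PowerSeries ℂ) ^ (par i * par q + par q + par k * par s + par s +
        (par k + par s) * (par i + par q)) • (tCoeff i q b a * tCoeff k s b' c) := by
  rw [superMul, Finset.sum_eq_single q, Finset.sum_eq_single k]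
  · simp only [T1, T2, if_true, parityAut_iterate_smul, parityAut_iterate_tCoeff, smul_mul_assoc,
      mul_smul_comm, smul_smul, ← pow_add]
    congr 1
    apply neg_one_pow_congr_mod_two
    rcases par_eq i with hi | hi <;> rcases par_eq q with hq | hq <;>
      rcases par_eq k with hk | hk <;> rcases par_eq s with hs | hs <;> simp [hi, hq, hk, hs]
  · intro l _ hl
    simp [T1, hl.symm]
  · simp
  · intro j _ hj
    simp [T2, hj]
  · simp

theorem superMul_T2_T1 {m n : ℕ} (b b' : Branch) (a c : ℤ) (i q k s : Fin (m + n)) :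
    superMul (T2 b' c) (T1 b a) i q k s =
      (-1 : PowerSeries ℂ) ^ (par i * par q + par q + par k * par s + par s) •
        (tCoeff k s b' c * tCoeff i q b a) := by
  rw [superMul, Finset.sum_eq_single i, Finset.sum_eq_single s]
  · simp only [T1, T2, if_true, parityAut_iterate_smul, parityAut_iterate_tCoeff, smul_mul_assoc,
      mul_smul_comm, smul_smul, ← pow_add]
    congr 1
    apply neg_one_pow_congr_mod_two
    rcases par_eq i with hi | hi <;> rcases par_eq q with hq | hq <;>
      rcases par_eq k with hk | hk <;> rcases par_eq s with hs | hs <;> simp [hi, hq, hk, hs]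
  · intro l _ hl
    simp [T1, hl]
  · simp
  · intro j _ hj
    simp [T2, hj.symm]
  · simp

theorem superMul_permP_left {m n : ℕ} (Y : Tensor m n) (i q k s : Fin (m + n)) :
    superMul (permP m n) Y i q k s =
      (-1 : PowerSeries ℂ) ^ ((par k + par i) * (par k + par q) + par k) • Y k q i s := by
  rw [superMul, Finset.sum_eq_single k, Finset.sum_eq_single i]
  · simp only [permP, and_self, if_true, parityAut_iterate_neg_one_pow]
    rw [pow_add, ← smul_smul]
    congr 1
    exact (neg_one_pow_smul_eq_mul _ _).symm
  · intro l _ hl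
    simp [permP, hl]
  · simp
  · intro j _ hj
    simp [permP, hj.symm]
  · simp

theorem superMul_permP_right {m n : ℕ} (X : Tensor m n) (i q k s : Fin (m + n)) :
    superMul X (permP m n) i q k s =
      (-1 : PowerSeries ℂ) ^ ((par k + par q) * (par s + par q) + par q) •
        (parityAut m n)^[par s + par q + par q + par s] (X i s k q) := by
  rw [superMul, Finset.sum_eq_single s, Finset.sum_eq_single q]
  · simp only [permP, and_self, if_true]
    rw [pow_add, ← smul_smul]
    congr 1
    exact (neg_one_pow_smul_eq_mul' _ _).symm
  · intro l _ hl
    simp [permP, hl]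
  · simp
  · intro j _ hj
    simp [permP, hj.symm]
  · simp

/-! ### The action of `t_{iq}^{(1)}` on the generating series -/

theorem tCoeff_minus_zero {m n : ℕ} (i j : Fin (m + n)) :
    tCoeff i j .minus 0 = if i = j then 1 else 0 := by
  change tCoeff i j .minus (Int.ofNat 0) = _
  simp [tCoeff]

theorem tCoeff_minus_neg_one {m n : ℕ} (i j : Fin (m + n)) :
    tCoeff i j .minus (0 - 1) = h • FreeAlgebra.ι (PowerSeries ℂ) (Gen.pos i j 0) := rfl

/-- The supercommutators of the `t_{iq}^{(1)}` with the generating series. -/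
theorem supercommutator_first {m n : ℕ} (b : Branch) (c : ℤ) (i q k s : Fin (m + n)) :
    (-1 : PowerSeries ℂ) ^ ((par k + par s) * (par i + par q)) •
        (toDY m n (FreeAlgebra.ι _ (Gen.pos i q 0)) * toDY m n (tCoeff k s b c)) =
      toDY m n (tCoeff k s b c) * toDY m n (FreeAlgebra.ι _ (Gen.pos i q 0)) +
        (if k = q then (-1 : PowerSeries ℂ) ^ (par i * par q + par s * (par i + par q)) •
          toDY m n (tCoeff i s b c) else 0) -
        (if i = s then (-1 : PowerSeries ℂ) ^ (par i) •
          toDY m n (tCoeff k q b c) else 0) := by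
  let x : Free m n := FreeAlgebra.ι _ (Gen.pos i q 0)
  let t : Fin (m + n) → Fin (m + n) → Free m n := fun k s => tCoeff k s b c
  -- The sign exponent carried by the entry `(i, q, k, s)` of `T_2 T_1`; it is removed at the end by
  -- multiplying with `(-1) ^ ε`.
  let ε := par i * par q + par q + par k * par s + par s
  let r : Free m n := (-1 : PowerSeries ℂ) ^ (ε + (par k + par s) * (par i + par q)) • (x * t k s)
    - (-1 : PowerSeries ℂ) ^ ε • (t k s * x)
    - (if k = q then (-1 : PowerSeries ℂ) ^ (ε + (par i * par q + par s * (par i + par q))) •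
        t i s else 0)
    + (if i = s then (-1 : PowerSeries ℂ) ^
        (ε + par i) • t k q else 0)
  -- At `u^0` the factor `T_1` contributes either its coefficient `h t^{(1)}` at `u⁻¹` or the
  -- identity. The identity commutes with `T_2`, so the terms from `v T_1 T_2` cancel, and
  -- everything left, including the two `P` terms, has a factor `h`.
  have hr : rttDefect .minus b 0 c i q k s = h • r := by
    have e1 : superMul (T1 .minus 0) (T2 b (c - 1)) i q k s =
        superMul (T2 b (c - 1)) (T1 .minus 0) i q k s := by
      rw [superMul_T1_T2, superMul_T2_T1, tCoeff_minus_zero]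
      split_ifs with hiq
      · subst hiq
        rw [one_mul, mul_one]
        congr 1
        apply neg_one_pow_congr_mod_two
        rcases par_eq i with hi | hi <;>
          rcases par_eq k with hk | hk <;> rcases par_eq s with hs | hs <;> simp [hi, hk, hs]
      · simp
    have e2 : superMul (permP m n) (superMul (T1 .minus 0) (T2 b c)) i q k s =
        if k = q then (-1 : PowerSeries ℂ) ^ (ε + (par i * par q + par s * (par i + par q))) •
          t i s else 0 := by
      rw [superMul_permP_left, superMul_T1_T2, tCoeff_minus_zero]
      split_ifs with hkq
      · subst hkq
        rw [one_mul, smul_smul, ← pow_add]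
        congr 1
        apply neg_one_pow_congr_mod_two
        rcases par_eq i with hi | hi <;>
          rcases par_eq k with hk | hk <;> rcases par_eq s with hs | hs <;> simp [ε, hi, hk, hs]
      · simp
    have e3 : superMul (superMul (T2 b c) (T1 .minus 0)) (permP m n) i q k s =
        if i = s then (-1 : PowerSeries ℂ) ^
          (ε + par i) • t k q else 0 := by
      rw [superMul_permP_right, superMul_T2_T1, tCoeff_minus_zero]
      split_ifs with his
      · subst his
        rw [mul_one, parityAut_iterate_smul, parityAut_iterate_tCoeff, smul_smul, smul_smul,
          ← pow_add, ← pow_add]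
        congr 1
        apply neg_one_pow_congr_mod_two
        rcases par_eq i with hi | hi <;>
          rcases par_eq k with hk | hk <;> rcases par_eq q with hs | hs <;> simp [ε, hi, hk, hs]
      · simp
    simp only [rttDefect, Pi.sub_apply, Pi.smul_apply]
    rw [e1, e2, e3, superMul_T1_T2 .minus b (0 - 1), superMul_T2_T1 .minus b (0 - 1),
      tCoeff_minus_neg_one, smul_mul_assoc, mul_smul_comm, smul_comm _ h, smul_comm _ h]
    simp only [r, smul_sub, smul_add]
    abel
  have hmem : r ∈ satIdeal m n := by
    refine mem_satIdeal_of_h_pow_smul 1 ((TwoSidedIdeal.mem_mk' _ _ _ _ _ _ _).2 ⟨0, ?_⟩)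
    rw [pow_zero, one_smul, pow_one, ← hr]
    exact TwoSidedIdeal.subset_span ⟨_, _, _, _, _, _, _, _, by simp, rfl⟩
  have h0 := congrArg (fun y => (-1 : PowerSeries ℂ) ^ ε • y) (toDY_eq_zero hmem)
  have hsq : (-1 : PowerSeries ℂ) ^ ε * (-1) ^ ε = 1 := by rw [← mul_pow]; simp
  simp only [r, map_sub, map_add, map_smul, map_mul, apply_ite (toDY m n), map_zero, smul_sub,
    smul_add, smul_zero, smul_ite, pow_add _ ε, smul_smul, ← mul_assoc, hsq, one_mul, one_smul] at h0
  have rearrange : ∀ A B C D : DY m n, A - B - C + D = 0 → A = B + C - D := by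
    intro A B C D h
    rw [← sub_eq_zero, ← h]
    abel
  exact rearrange _ _ _ _ h0

/-- The rows other than `q` of the action of `t_{iq}^{(1)}` on the generating series. -/
theorem first_mul_row {m n : ℕ} (b : Branch) (c : ℤ) {i q k : Fin (m + n)} (s : Fin (m + n))
    (hk : k ≠ q) :
    ((-1 : PowerSeries ℂ) ^ ((par i + par q) * par k) •
        toDY m n (FreeAlgebra.ι _ (Gen.pos i q 0))) * toDY m n (tCoeff k s b c) =
      toDY m n (tCoeff k s b c) * ((-1 : PowerSeries ℂ) ^ ((par i + par q) * par s) •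
        toDY m n (FreeAlgebra.ι _ (Gen.pos i q 0))) +
      if s = i then toDY m n (tCoeff k q b c) * ((-1) ^ (par i * par q + 1)) else 0 := by
  have key := congrArg (fun y => (-1 : PowerSeries ℂ) ^ ((par i + par q) * par s) • y)
    (supercommutator_first b c i q k s)
  simp only [if_neg hk, add_zero, smul_sub, smul_smul, ← pow_add] at key
  rw [smul_mul_assoc, mul_smul_comm, neg_one_pow_congr_mod_two (a := (par i + par q) * par k)
    (b := (par i + par q) * par s + (par k + par s) * (par i + par q)), key, sub_eq_add_neg]
  · congr 1
    by_cases his : s = i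
    · subst his
      rw [if_pos rfl, if_pos rfl, smul_smul, ← pow_add, ← neg_smul, ← neg_one_mul, ← pow_succ']
      refine Eq.trans ?_ (neg_one_pow_smul_eq_mul' (K := PowerSeries ℂ) _ _)
      rw [neg_one_pow_congr_mod_two]
      rcases par_eq s with hs | hs <;> rcases par_eq q with hq | hq <;> simp [hs, hq]
    · rw [if_neg his, if_neg (Ne.symm his), smul_zero, neg_zero]
  · rcases par_eq i with hi | hi <;> rcases par_eq q with hq | hq <;>
      rcases par_eq k with hk | hk <;> rcases par_eq s with hs | hs <;> simp [hi, hq, hk, hs]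

/-- Mirror image of `first_mul_row`: away from column `i` the same relation is a row operation,
adding row `i` to row `q` up to sign. It serves the lower triangular factor. -/
theorem first_mul_column {m n : ℕ} (b : Branch) (c : ℤ) {i q s : Fin (m + n)} (k : Fin (m + n))
    (hs : s ≠ i) :
    toDY m n (tCoeff k s b c) * ((-1 : PowerSeries ℂ) ^ ((par i + par q) * par s) •
        toDY m n (FreeAlgebra.ι _ (Gen.pos i q 0))) =
      ((-1 : PowerSeries ℂ) ^ ((par i + par q) * par k) •
        toDY m n (FreeAlgebra.ι _ (Gen.pos i q 0))) * toDY m n (tCoeff k s b c) +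
      if k = q then ((-1) ^ (par i * par q + 1)) * toDY m n (tCoeff i s b c) else 0 := by
  have key := congrArg (fun y => (-1 : PowerSeries ℂ) ^ ((par i + par q) * par s) • y)
    (supercommutator_first b c i q k s)
  simp only [if_neg hs.symm, sub_zero, smul_add, smul_smul, ← pow_add] at key
  rw [smul_mul_assoc, mul_smul_comm, neg_one_pow_congr_mod_two (a := (par i + par q) * par k)
    (b := (par i + par q) * par s + (par k + par s) * (par i + par q)), key, add_assoc,
    left_eq_add]
  · by_cases hkq : k = q
    · subst hkq
      rw [if_pos rfl, if_pos rfl, smul_smul, ← pow_add, add_eq_zero_iff_neg_eq, ← neg_smul]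
      refine Eq.trans ?_ (neg_one_pow_smul_eq_mul (K := PowerSeries ℂ) _ _)
      rw [← neg_one_mul, ← pow_succ', neg_one_pow_congr_mod_two]
      rcases par_eq s with hs | hs <;> rcases par_eq i with hq | hq <;>
        rcases par_eq k with hk | hk <;> simp [hs, hq, hk]
    · rw [if_neg hkq, if_neg hkq, smul_zero, add_zero]
  · rcases par_eq i with hi | hi <;> rcases par_eq q with hq | hq <;>
      rcases par_eq k with hk | hk <;> rcases par_eq s with hs | hs <;> simp [hi, hq, hk, hs]

/-! ### From operations on `T` to its triangular factors -/

/-- An element acting on the rows of `T` above `i` by the elementary column operation adding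
column `q` to column `i` acts in the same way on these rows of the upper triangular factor. -/
theorem GaussDecomposition.upper_intertwine {N : ℕ} {S : Type} [Ring S]
    {T : Matrix (Fin N) (Fin N) S} (g : GaussDecomposition T) (hd : ∀ i, IsUnit (g.D i i))
    (G : Fin N → S) (c : S) {i q : Fin N}
    (hT : ∀ a b, a < i → G a * T a b = T a b * G b + if b = i then T a q * c else 0)
    {a : Fin N} (ha : a < i) : G a * g.E a i = g.E a i * G i + g.E a q * c := by
  have hFD : ∀ i j, (g.F * g.D) i j = g.F i j * g.D j j := by
    intro i j
    rw [Matrix.mul_apply, Finset.sum_eq_single j]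
    · intro c _ hc
      rw [g.D_diag hc, mul_zero]
    · simp
  have hmul : ∀ (M : Matrix (Fin N) (Fin N) S) a b,
      (M * (Matrix.diagonal G + Matrix.single q i c)) a b =
        M a b * G b + if b = i then M a q * c else 0 := by
    intro M a b
    rw [mul_add, Matrix.add_apply, Matrix.mul_diagonal]
    congr 1
    split_ifs with hb
    · rw [hb, Matrix.mul_single_apply_same]
    · exact Matrix.mul_single_apply_of_ne (hbj := hb) ..
  -- The operation is right multiplication by `diag G + c e_{qi}`, which is diagonal in the columns
  -- before `i`; hence the bound `J = i`.
  have key := intertwine (U := g.F * g.D) (U' := g.F * g.D) (E := g.E) (E' := g.E)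
    (L := Matrix.diagonal G + Matrix.single q i c) G i
    (fun i j hij => by rw [hFD, g.F_upper i j hij, zero_mul])
    (fun i j hij => by rw [hFD, g.F_upper i j hij, zero_mul])
    g.E_diag g.E_lower g.E_diag g.E_lower
    (fun a b hb => by
      have hbi : i ≠ b := fun h => by rw [h] at hb; exact lt_irrefl _ hb
      rw [Matrix.add_apply, Matrix.single_apply, if_neg (fun h => hbi h.2), add_zero,
        Matrix.diagonal_apply]
      split_ifs with hab
      · rw [hab]
      · rfl)
    (fun i x hx => by
      rw [hFD, g.F_diag, one_mul] at hx
      exact (hd i).mul_right_eq_zero.1 hx)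
    (fun a b ha => by rw [← mul_assoc, ← g.eq, hmul, hT a b ha])
  rw [(key a ha).2 i, hmul, if_pos rfl]

/-- The entries of the upper triangular factor lie in a subring that contains those next to the
diagonal, if suitable elements of the subring act on `T` by elementary column operations. -/
theorem GaussDecomposition.upper_mem {N : ℕ} {S : Type} [Ring S] (B : Subring S) {z : S}
    (hz : ∀ s, Commute z s) (hreg : ∀ s, z * s = 0 → s = 0)
    {T : Matrix (Fin N) (Fin N) S} (g : GaussDecomposition T) (hd : ∀ i, IsUnit (g.D i i))
    {E : Matrix (Fin N) (Fin N) S} (hE : g.E = 1 + z • E)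
    (hbase : ∀ i q : Fin N, (q : ℕ) = i + 1 → E i q ∈ B)
    (hG : ∀ i q : Fin N, (q : ℕ) = i + 1 → ∃ (G : Fin N → S) (c : S), (∀ a, G a ∈ B) ∧ c ∈ B ∧
      c * c = 1 ∧
      ∀ a b, a < i → G a * T a b = T a b * G b + if b = i then T a q * c else 0) :
    ∀ a q : Fin N, a < q → E a q ∈ B := by
  have hoff : ∀ a b, a ≠ b → g.E a b = z * E a b := by
    intro a b hab
    rw [hE, Matrix.add_apply, Matrix.one_apply_ne hab, zero_add]
    rfl
  have step : ∀ (a : Fin N) (k : ℕ) (hk : k < N), (a : ℕ) + 1 ≤ k → E a ⟨k, hk⟩ ∈ B := by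
    intro a k hk hak
    induction k, hak using Nat.le_induction with
    | base => exact hbase _ _ rfl
    | succ k hak ih =>
      have hkN : k < N := by omega
      obtain ⟨G, c, hGB, hcB, hcc, hT⟩ := hG ⟨k, hkN⟩ ⟨k + 1, hk⟩ rfl
      have hai : a < ⟨k, hkN⟩ := hak
      have haq : a < ⟨k + 1, hk⟩ := Nat.lt_succ_of_lt hak
      -- Off the diagonal the entries are `z` times those of `E`; cancelling `z` and using `c * c =
      -- 1` expresses the next entry through the previous one.
      have h1 := g.upper_intertwine hd G c hT hai
      rw [hoff _ _ hai.ne, hoff _ _ haq.ne, ← mul_assoc, ← (hz _).eq, mul_assoc, mul_assoc,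
        mul_assoc, ← mul_add] at h1
      have h2 := hreg _ ((mul_sub _ _ _).trans (sub_eq_zero.2 h1))
      have h3 : E a ⟨k + 1, hk⟩ = (G a * E a ⟨k, hkN⟩ - E a ⟨k, hkN⟩ * G ⟨k, hkN⟩) * c := by
        rw [sub_eq_zero.1 h2, add_sub_cancel_left, mul_assoc, hcc, mul_one]
      rw [h3]
      exact mul_mem (sub_mem (mul_mem (hGB _) (ih hkN)) (mul_mem (ih hkN) (hGB _))) hcB
  exact fun a q haq => step a q q.2 haq

/-- The transpose of a Gauss decomposition over the opposite ring. -/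
def GaussDecomposition.op {N : ℕ} {S : Type} [Ring S] {T : Matrix (Fin N) (Fin N) S}
    (g : GaussDecomposition T) : GaussDecomposition (T.transpose.map MulOpposite.op) where
  F := g.E.transpose.map MulOpposite.op
  D := g.D.transpose.map MulOpposite.op
  E := g.F.transpose.map MulOpposite.op
  F_diag i := by simp [g.E_diag]
  F_upper i j hij := by simp [g.E_lower j i hij]
  D_diag i j hij := by simp [g.D_diag hij.symm]
  E_diag i := by simp [g.F_diag]
  E_lower i j hij := by simp [g.F_upper j i hij]
  eq := by
    have hmul : ∀ M M' : Matrix (Fin N) (Fin N) S, (M * M').transpose.map MulOpposite.op =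
        M'.transpose.map MulOpposite.op * M.transpose.map MulOpposite.op := by
      intro M M'
      ext i j
      simp [Matrix.mul_apply]
    rw [mul_assoc, ← hmul, ← hmul, ← g.eq]

/-- Transposition over the opposite ring exchanges the two triangular factors and turns row
operations into column operations. -/
theorem GaussDecomposition.lower_mem {N : ℕ} {S : Type} [Ring S] (B : Subring S) {z : S}
    (hz : ∀ s, Commute z s) (hreg : ∀ s, z * s = 0 → s = 0)
    {T : Matrix (Fin N) (Fin N) S} (g : GaussDecomposition T) (hd : ∀ i, IsUnit (g.D i i))
    {F : Matrix (Fin N) (Fin N) S} (hF : g.F = 1 + z • F)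
    (hbase : ∀ i q : Fin N, (q : ℕ) = i + 1 → F q i ∈ B)
    (hG : ∀ i q : Fin N, (q : ℕ) = i + 1 → ∃ (G : Fin N → S) (c : S), (∀ a, G a ∈ B) ∧ c ∈ B ∧
      c * c = 1 ∧
      ∀ a b, a < i → T b a * G a = G b * T b a + if b = i then c * T q a else 0) :
    ∀ a q : Fin N, a < q → F q a ∈ B := by
  refine g.op.upper_mem B.op (z := MulOpposite.op z) (fun s => ?_) (fun s hs => ?_) (fun i => ?_)
    (E := F.transpose.map MulOpposite.op) ?_ hbase ?_
  · exact MulOpposite.unop_injective (hz s.unop).symm.eq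
  · refine MulOpposite.unop_injective (hreg _ ?_)
    rw [(hz _).eq]
    exact congrArg MulOpposite.unop hs
  · exact (hd i).op
  · change g.F.transpose.map MulOpposite.op = _
    rw [hF]
    ext i j
    simp only [Matrix.map_apply, Matrix.transpose_apply, Matrix.add_apply, Matrix.smul_apply,
      smul_eq_mul, MulOpposite.op_add, (hz _).eq, MulOpposite.op_mul, Matrix.one_apply,
      eq_comm (a := j)]
    congr 1
    split_ifs <;> rfl
  · intro i q hiq
    obtain ⟨G, c, hGB, hcB, hcc, hT⟩ := hG i q hiq
    refine ⟨fun a => MulOpposite.op (G a), MulOpposite.op c, hGB, hcB,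
      MulOpposite.unop_injective hcc, fun a b hab => MulOpposite.unop_injective ?_⟩
    have := hT a b hab
    split_ifs with hb
    · rw [if_pos hb] at this
      exact this
    · rw [if_neg hb] at this
      exact this

/-- The first-order part of a product of matrices `1 + z M`. -/
theorem exists_eq_add_smul_of_gauss {N : ℕ} {S : Type} [Ring S] {z : S}
    (hz : ∀ s, Commute z s) (hreg : ∀ s, z * s = 0 → s = 0) {T F D E : Matrix (Fin N) (Fin N) S}
    (h : 1 + z • T = (1 + z • F) * (1 + z • D) * (1 + z • E)) :
    T = F + D + E + z • (F * D + F * E + D * E + z • (F * D * E)) := by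
  have hcomm : ∀ M M' : Matrix (Fin N) (Fin N) S, M * (z • M') = z • (M * M') := by
    intro M M'
    ext i j
    simp only [Matrix.mul_apply, Matrix.smul_apply, smul_eq_mul, Finset.mul_sum]
    refine Finset.sum_congr rfl fun k _ => ?_
    rw [← mul_assoc, ← (hz _).eq, mul_assoc]
  have h1 : z • (T - (F + D + E + z • (F * D + F * E + D * E + z • (F * D * E)))) = 0 := by
    have h2 : z • T = (1 + z • F) * (1 + z • D) * (1 + z • E) - 1 := by rw [← h]; abel
    rw [smul_sub, h2]
    simp only [mul_add, add_mul, mul_one, one_mul, hcomm, Matrix.smul_mul, smul_add]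
    abel
  refine sub_eq_zero.1 ?_
  ext i j
  exact hreg _ (congrFun (congrFun h1 i) j)

/-! ### Series with coefficients in a subring -/

/-- The power series with coefficients in a subring. -/
def coeffSubring {R : Type} [Ring R] (B : Subring R) : Subring (PowerSeries R) where
  carrier := {p | ∀ k, PowerSeries.coeff k p ∈ B}
  mul_mem' hp hq k := by
    rw [PowerSeries.coeff_mul]
    exact sum_mem fun x _ => mul_mem (hp _) (hq _)
  one_mem' k := by
    rw [PowerSeries.coeff_one]
    split_ifs
    · exact one_mem _
    · exact zero_mem _
  add_mem' hp hq k := by rw [map_add]; exact add_mem (hp k) (hq k)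
  zero_mem' k := by rw [map_zero]; exact zero_mem _
  neg_mem' hp k := by rw [map_neg]; exact neg_mem (hp k)

theorem C_mem_coeffSubring {R : Type} [Ring R] {B : Subring R} {x : R} (hx : x ∈ B) :
    PowerSeries.C x ∈ coeffSubring B := by
  intro k
  rw [PowerSeries.coeff_C]
  split_ifs
  · exact hx
  · exact zero_mem _

theorem X_mem_coeffSubring {R : Type} [Ring R] (B : Subring R) :
    PowerSeries.X ∈ coeffSubring B := by
  intro k
  rw [PowerSeries.coeff_X]
  split_ifs
  · exact one_mem _
  · exact zero_mem _

/-! ### Gauss decompositions of `T⁻(u)` and `T⁺(u)` -/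

section

open PowerSeries (C X coeff)

/-- Gauss decompositions of matrices `1 + z T` with all factors of the same form. -/
theorem exists_gaussDecomposition {N : ℕ} {S : Type} [Ring S] {z : S}
    (hz : ∀ s, Commute z s) (hreg : ∀ s, z * s = 0 → s = 0) (hu : ∀ s, IsUnit (1 + z * s))
    {T T' : Matrix (Fin N) (Fin N) S} (hT : T = 1 + z • T') :
    ∃ (g : GaussDecomposition T) (F : Matrix (Fin N) (Fin N) S) (d : Fin N → S)
      (E : Matrix (Fin N) (Fin N) S),
      g.F = 1 + z • F ∧ (∀ i, g.D i i = 1 + z * d i) ∧ g.E = 1 + z • E ∧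
      (∀ i j, i ≤ j → F i j = 0) ∧ (∀ i j, j ≤ i → E i j = 0) ∧
      T' = F + Matrix.diagonal d + E + z • (F * Matrix.diagonal d + F * E + Matrix.diagonal d * E
        + z • (F * Matrix.diagonal d * E)) := by
  obtain ⟨F, d, E, hF, hE, h⟩ := exists_gauss_factors z hz hu N T'
  refine ⟨⟨1 + z • F, 1 + z • Matrix.diagonal d, 1 + z • E, ?_, ?_, ?_, ?_, ?_, hT.trans h⟩,
    F, d, E, rfl, ?_, rfl, hF, hE, exists_eq_add_smul_of_gauss hz hreg h⟩
  · intro i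
    simp [hF i i le_rfl]
  · intro i j hij
    simp [hF i j hij.le, hij.ne]
  · intro i j hij
    simp [hij]
  · intro i
    simp [hE i i le_rfl]
  · intro i j hij
    simp [hE i j hij.le, hij.ne']
  · intro i
    simp

/-- The constant power series `h`. -/
noncomputable def hSeries (m n : ℕ) : PowerSeries (DY m n) := C (algebraMap _ (DY m n) h)

variable {m n : ℕ}

theorem hSeries_mul (p : PowerSeries (DY m n)) :
    hSeries m n * p = PowerSeries.mk fun s => h • coeff s p := by
  ext1 s
  rw [hSeries, PowerSeries.coeff_C_mul, PowerSeries.coeff_mk, Algebra.smul_def]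

theorem hSeries_commute (p : PowerSeries (DY m n)) : Commute (hSeries m n) p := by
  refine PowerSeries.ext fun s => ?_
  rw [hSeries, PowerSeries.coeff_C_mul, PowerSeries.coeff_mul_C, Algebra.commutes]

theorem hSeries_regular (p : PowerSeries (DY m n)) (hp : hSeries m n * p = 0) : p = 0 := by
  ext1 s
  rw [hSeries_mul] at hp
  have := congrArg (coeff s) hp
  rw [PowerSeries.coeff_mk, map_zero] at this
  rw [h_smul_eq_zero this, map_zero]

theorem isUnit_one_add_hSeries_mul (p : PowerSeries (DY m n)) : IsUnit (1 + hSeries m n * p) := by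
  rw [PowerSeries.isUnit_iff_constantCoeff, map_add, map_one, map_mul, hSeries,
    PowerSeries.constantCoeff_C, ← Algebra.smul_def]
  exact isUnit_one_add_h_smul _

theorem X_mul_hSeries_commute (p : PowerSeries (DY m n)) : Commute (X * hSeries m n) p :=
  (PowerSeries.commute_X p).symm.mul_left (hSeries_commute p)

theorem X_mul_hSeries_regular (p : PowerSeries (DY m n)) (hp : X * hSeries m n * p = 0) :
    p = 0 := by
  rw [mul_assoc] at hp
  exact hSeries_regular p (PowerSeries.X_mul_cancel (hp.trans (mul_zero _).symm))

theorem isUnit_one_add_X_mul_hSeries_mul (p : PowerSeries (DY m n)) :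
    IsUnit (1 + X * hSeries m n * p) := by
  rw [PowerSeries.isUnit_iff_constantCoeff, map_add, map_one, map_mul, map_mul,
    PowerSeries.constantCoeff_X, zero_mul, zero_mul, add_zero]
  exact isUnit_one

theorem mk_h_smul_injective {f f' : ℕ → DY m n}
    (hf : (PowerSeries.mk fun s => h • f s) = PowerSeries.mk fun s => h • f' s) : f = f' := by
  funext s
  have := congrArg (coeff s) hf
  rw [PowerSeries.coeff_mk, PowerSeries.coeff_mk, ← sub_eq_zero, ← smul_sub] at this
  exact sub_eq_zero.1 (h_smul_eq_zero this)

/-- The matrices `T⁻(u)` and `T⁺(u)`. -/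
noncomputable def Tmatrix (m n : ℕ) :
    Branch → Matrix (Fin (m + n)) (Fin (m + n)) (PowerSeries (DY m n))
  | .minus => Tminus m n
  | .plus => Tplus m n

/-- The exponent is the same for all entries, so relations among the `tCoeff` at a fixed exponent
carry over to the matrices of series. -/
theorem exists_coeff_Tmatrix (b : Branch) (s : ℕ) : ∃ a : ℤ, ∀ i j : Fin (m + n),
    coeff s (Tmatrix m n b i j) = toDY m n (tCoeff i j b a) := by
  cases b with
  | minus => exact ⟨-(s : ℤ), fun i j => by rw [Tmatrix, Tminus, PowerSeries.coeff_mk]⟩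
  | plus => exact ⟨(s : ℤ), fun i j => by rw [Tmatrix, Tplus, PowerSeries.coeff_mk]⟩

/-- The element `t_{iq}^{(1)}` of the double Yangian. -/
noncomputable def tFirst (i q : Fin (m + n)) : DY m n :=
  toDY m n (FreeAlgebra.ι _ (Gen.pos i q 0))

theorem tFirst_mul_Tmatrix (b : Branch) {i q a : Fin (m + n)} (s : Fin (m + n)) (ha : a ≠ q) :
    C ((-1 : PowerSeries ℂ) ^ ((par i + par q) * par a) • tFirst i q) * Tmatrix m n b a s =
      Tmatrix m n b a s * C ((-1 : PowerSeries ℂ) ^ ((par i + par q) * par s) • tFirst i q) +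
      if s = i then Tmatrix m n b a q * C ((-1) ^ (par i * par q + 1)) else 0 := by
  ext1 r
  obtain ⟨c, hc⟩ := exists_coeff_Tmatrix (m := m) (n := n) b r
  have := first_mul_row b c (i := i) s ha
  split_ifs with hs
  · rw [if_pos hs] at this
    rw [map_add, PowerSeries.coeff_C_mul, PowerSeries.coeff_mul_C, PowerSeries.coeff_mul_C, hc, hc]
    exact this
  · rw [if_neg hs] at this
    rw [map_add, PowerSeries.coeff_C_mul, PowerSeries.coeff_mul_C, hc, map_zero]
    exact this

theorem Tmatrix_mul_tFirst (b : Branch) {i q s : Fin (m + n)} (a : Fin (m + n)) (hs : s ≠ i) :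
    Tmatrix m n b a s * C ((-1 : PowerSeries ℂ) ^ ((par i + par q) * par s) • tFirst i q) =
      C ((-1 : PowerSeries ℂ) ^ ((par i + par q) * par a) • tFirst i q) * Tmatrix m n b a s +
      if a = q then C ((-1) ^ (par i * par q + 1)) * Tmatrix m n b i s else 0 := by
  ext1 r
  obtain ⟨c, hc⟩ := exists_coeff_Tmatrix (m := m) (n := n) b r
  have := first_mul_column b c (q := q) a hs
  split_ifs with ha
  · rw [if_pos ha] at this
    rw [map_add, PowerSeries.coeff_C_mul, PowerSeries.coeff_mul_C, PowerSeries.coeff_C_mul, hc, hc]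
    exact this
  · rw [if_neg ha] at this
    rw [map_add, PowerSeries.coeff_C_mul, PowerSeries.coeff_mul_C, hc, map_zero]
    exact this

theorem neg_one_pow_mul_self {A : Type*} [Ring A] (k : ℕ) : (-1 : A) ^ k * (-1) ^ k = 1 := by
  rw [← pow_add, (Even.add_self k).neg_one_pow]

/-- If a subalgebra contains the coefficients of the diagonal and of the entries next to the
diagonal in the Gauss factors, it contains the coefficients of the generating series. -/
theorem Tmatrix_mem (b : Branch) (A : Subalgebra (PowerSeries ℂ) (DY m n))
    {z : PowerSeries (DY m n)} (hz : ∀ s, Commute z s) (hreg : ∀ s, z * s = 0 → s = 0)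
    (hu : ∀ s, IsUnit (1 + z * s)) (hzA : z ∈ coeffSubring A.toSubring)
    (g : GaussDecomposition (Tmatrix m n b))
    {T F E : Matrix (Fin (m + n)) (Fin (m + n)) (PowerSeries (DY m n))}
    {d : Fin (m + n) → PowerSeries (DY m n)}
    (hF : g.F = 1 + z • F) (hD : ∀ i, g.D i i = 1 + z * d i) (hE : g.E = 1 + z • E)
    (hF0 : ∀ i j, i ≤ j → F i j = 0) (hE0 : ∀ i j, j ≤ i → E i j = 0)
    (hT : T = F + Matrix.diagonal d + E + z • (F * Matrix.diagonal d + F * E +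
      Matrix.diagonal d * E + z • (F * Matrix.diagonal d * E)))
    (hFA : ∀ i q : Fin (m + n), (q : ℕ) = i + 1 → F q i ∈ coeffSubring A.toSubring)
    (hdA : ∀ i, d i ∈ coeffSubring A.toSubring)
    (hEA : ∀ i q : Fin (m + n), (q : ℕ) = i + 1 → E i q ∈ coeffSubring A.toSubring)
    (htA : ∀ i q : Fin (m + n), (q : ℕ) = i + 1 → tFirst i q ∈ A ∧ tFirst q i ∈ A)
    (i j : Fin (m + n)) : T i j ∈ coeffSubring A.toSubring := by
  have hd : ∀ i, IsUnit (g.D i i) := fun i => by rw [hD]; exact hu _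
  have hsign : ∀ k : ℕ, C ((-1 : DY m n) ^ k) ∈ coeffSubring A.toSubring ∧
      C ((-1 : DY m n) ^ k) * C ((-1 : DY m n) ^ k) = 1 := by
    intro k
    refine ⟨C_mem_coeffSubring (pow_mem (neg_mem (one_mem A.toSubring)) k), ?_⟩
    rw [← map_mul, neg_one_pow_mul_self, map_one]
  have hEall : E ∈ (coeffSubring A.toSubring).matrix := by
    intro a q
    rcases lt_or_ge a q with haq | haq
    · refine g.upper_mem _ hz hreg hd hE hEA (fun i q hiq => ?_) a q haq
      refine ⟨fun a => C ((-1 : PowerSeries ℂ) ^ ((par i + par q) * par a) • tFirst i q), _,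
        fun a => C_mem_coeffSubring (A.smul_mem (htA i q hiq).1 _), (hsign _).1, (hsign _).2,
        fun a b hab => tFirst_mul_Tmatrix _ _ ?_⟩
      -- The rows used lie above `i`, so they avoid row `q = i + 1`, where the relation has a
      -- further term.
      rintro rfl
      exact absurd (Fin.lt_def.1 hab) (by omega)
    · rw [hE0 _ _ haq]
      exact zero_mem _
  have hFall : F ∈ (coeffSubring A.toSubring).matrix := by
    intro q a
    rcases lt_or_ge a q with haq | haq
    · refine g.lower_mem _ hz hreg hd hF hFA (fun i q hiq => ?_) a q haq
      refine ⟨fun a => C ((-1 : PowerSeries ℂ) ^ ((par q + par i) * par a) • tFirst q i), _,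
        fun a => C_mem_coeffSubring (A.smul_mem (htA i q hiq).2 _), (hsign _).1, (hsign _).2,
        fun a b hab => Tmatrix_mul_tFirst _ _ ?_⟩
      rintro rfl
      exact absurd (Fin.lt_def.1 hab) (by omega)
    · rw [hF0 _ _ haq]
      exact zero_mem _
  have hdall : Matrix.diagonal d ∈ (coeffSubring A.toSubring).matrix := by
    intro a q
    rw [Matrix.diagonal_apply]
    split_ifs
    · exact hdA a
    · exact zero_mem _
  have hsmul : ∀ M ∈ (coeffSubring A.toSubring).matrix (n := Fin (m + n)),
      z • M ∈ (coeffSubring A.toSubring).matrix :=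
    fun M hM a q => (coeffSubring A.toSubring).mul_mem hzA (hM a q)
  have hTall : T ∈ (coeffSubring A.toSubring).matrix := by
    have hFd := mul_mem hFall hdall
    have hquad := add_mem (add_mem (add_mem hFd (mul_mem hFall hEall)) (mul_mem hdall hEall))
      (hsmul _ (mul_mem hFd hEall))
    rw [hT]
    exact add_mem (add_mem (add_mem hFall hdall) hEall) (hsmul _ hquad)
  exact hTall i j

theorem Tminus_eq : Tminus m n = 1 + (X * hSeries m n) •
    Matrix.of fun i j => PowerSeries.mk fun s =>
      toDY m n (FreeAlgebra.ι _ (Gen.pos i j s)) := by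
  refine Matrix.ext fun i j => PowerSeries.ext fun s => ?_
  rw [Tminus, Matrix.add_apply, Matrix.smul_apply, smul_eq_mul, mul_assoc, hSeries_mul, map_add,
    Matrix.of_apply]
  cases s with
  | zero =>
    rw [PowerSeries.coeff_mk, PowerSeries.coeff_zero_X_mul, add_zero, Nat.cast_zero, neg_zero,
      tCoeff_minus_zero, Matrix.one_apply]
    split_ifs <;> simp
  | succ s =>
    rw [PowerSeries.coeff_mk, PowerSeries.coeff_succ_X_mul, PowerSeries.coeff_mk,
      PowerSeries.coeff_mk, ← map_smul]
    have h0 : coeff (s + 1) ((1 : Matrix (Fin (m + n)) (Fin (m + n)) (PowerSeries (DY m n))) i j)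
        = 0 := by
      rw [Matrix.one_apply]
      split_ifs <;> simp [PowerSeries.coeff_one]
    rw [h0, zero_add]
    rfl

/-- Here `z` has no factor `X`, because `t_{ij}^{(-1)}` already occurs in the constant coefficient.
-/
theorem Tplus_eq : Tplus m n = 1 + hSeries m n •
    Matrix.of fun i j => PowerSeries.mk fun s =>
      -toDY m n (FreeAlgebra.ι _ (Gen.neg i j s)) := by
  refine Matrix.ext fun i j => PowerSeries.ext fun s => ?_
  rw [Tplus, Matrix.add_apply, Matrix.smul_apply, smul_eq_mul, hSeries_mul, map_add,
    Matrix.of_apply, PowerSeries.coeff_mk, PowerSeries.coeff_mk, PowerSeries.coeff_mk]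
  change toDY m n (tCoeff i j .plus (Int.ofNat s)) = _
  rw [tCoeff, map_sub, map_smul, smul_neg, sub_eq_add_neg, Matrix.one_apply]
  congr 1
  by_cases hij : i = j <;> by_cases hs : s = 0 <;> simp [hij, hs, PowerSeries.coeff_one]


end

end DoubleYangian

/-! ### Existence, uniqueness and generation -/

open DoubleYangian in
theorem theorem3p4 (m n : ℕ) :
    ∃ G : DrinfeldData m n, (∀ G' : DrinfeldData m n, G' = G) ∧
      TopologicallyGenerates G.coefficients := by
  obtain ⟨gm, Fm, dm, Em, hFm, hDm, hEm, hFm0, hEm0, hTm⟩ := exists_gaussDecomposition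
    (S := PowerSeries (DY m n)) (z := PowerSeries.X * hSeries m n)
    X_mul_hSeries_commute X_mul_hSeries_regular isUnit_one_add_X_mul_hSeries_mul
    (Tminus_eq (m := m) (n := n))
  obtain ⟨gp, Fp, dp, Ep, hFp, hDp, hEp, hFp0, hEp0, hTp⟩ := exists_gaussDecomposition
    (S := PowerSeries (DY m n)) (z := hSeries m n)
    hSeries_commute hSeries_regular isUnit_one_add_hSeries_mul (Tplus_eq (m := m) (n := n))
  have hhi : ∀ i : Fin (m + n - 1), hi i ≠ lo i := fun i hi => by
    simpa [DoubleYangian.hi, lo] using congrArg Fin.val hi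
  let G : DrinfeldData m n :=
    { gaussMinus := gm
      gaussPlus := gp
      fPos := fun i s => PowerSeries.coeff s (Fm (hi i) (lo i))
      fNeg := fun i s => -PowerSeries.coeff s (Fp (hi i) (lo i))
      ePos := fun i s => PowerSeries.coeff s (Em (lo i) (hi i))
      eNeg := fun i s => -PowerSeries.coeff s (Ep (lo i) (hi i))
      dPos := fun j s => PowerSeries.coeff s (dm j)
      dNeg := fun j s => -PowerSeries.coeff s (dp j)
      fPos_eq := fun i => by
        rw [hFm, Matrix.add_apply, Matrix.one_apply_ne (hhi i), zero_add, Matrix.smul_apply,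
          smul_eq_mul, mul_assoc, hSeries_mul]
      ePos_eq := fun i => by
        rw [hEm, Matrix.add_apply, Matrix.one_apply_ne (hhi i).symm, zero_add, Matrix.smul_apply,
          smul_eq_mul, mul_assoc, hSeries_mul]
      dPos_eq := fun j => by rw [hDm, mul_assoc, hSeries_mul]
      fNeg_eq := fun i => by
        rw [hFp, Matrix.add_apply, Matrix.one_apply_ne (hhi i), zero_add, Matrix.smul_apply,
          smul_eq_mul, hSeries_mul]
        ext1 s
        simp
      eNeg_eq := fun i => by
        rw [hEp, Matrix.add_apply, Matrix.one_apply_ne (hhi i).symm, zero_add, Matrix.smul_apply,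
          smul_eq_mul, hSeries_mul]
        ext1 s
        simp
      dNeg_eq := fun j => by
        rw [hDp, hSeries_mul]
        ext1 s
        simp }
  refine ⟨G, fun G' => ?_, ?_⟩
  · have hm : G'.gaussMinus = G.gaussMinus := gm.eq_of_regular _ fun i => by
      rw [hDm]; exact isUnit_one_add_X_mul_hSeries_mul _
    have hp : G'.gaussPlus = G.gaussPlus := gp.eq_of_regular _ fun i => by
      rw [hDp]; exact isUnit_one_add_hSeries_mul _
    refine DrinfeldData.ext hm hp ?_ ?_ ?_ ?_ ?_ ?_ <;> funext i <;> apply mk_h_smul_injective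
    · exact PowerSeries.X_mul_cancel (by rw [← G'.fPos_eq, ← G.fPos_eq, hm])
    · exact neg_injective (by rw [← G'.fNeg_eq, ← G.fNeg_eq, hp])
    · exact PowerSeries.X_mul_cancel (by rw [← G'.ePos_eq, ← G.ePos_eq, hm])
    · exact neg_injective (by rw [← G'.eNeg_eq, ← G.eNeg_eq, hp])
    · exact PowerSeries.X_mul_cancel (add_left_cancel (by rw [← G'.dPos_eq, ← G.dPos_eq, hm]))
    · exact sub_right_injective (by
        change 1 - _ = 1 - _
        rw [← G'.dNeg_eq, ← G.dNeg_eq, hp])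
  · let A := Algebra.adjoin (PowerSeries ℂ) G.coefficients
    have hsub : ∀ x ∈ G.coefficients, x ∈ A := fun x hx => Algebra.subset_adjoin hx
    have hlohi : ∀ i q : Fin (m + n), (q : ℕ) = i + 1 → ∃ k : Fin (m + n - 1),
        i = lo k ∧ q = hi k := by
      intro i q hiq
      exact ⟨⟨i, by omega⟩, rfl, Fin.ext hiq⟩
    have hFmA : ∀ i q : Fin (m + n), (q : ℕ) = i + 1 → Fm q i ∈ coeffSubring A.toSubring := by
      intro i q hiq s
      obtain ⟨k, rfl, rfl⟩ := hlohi i q hiq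
      exact hsub _ (Or.inl ⟨k, s, Or.inl rfl⟩)
    have hEmA : ∀ i q : Fin (m + n), (q : ℕ) = i + 1 → Em i q ∈ coeffSubring A.toSubring := by
      intro i q hiq s
      obtain ⟨k, rfl, rfl⟩ := hlohi i q hiq
      exact hsub _ (Or.inl ⟨k, s, Or.inr (Or.inr (Or.inl rfl))⟩)
    have hFpA : ∀ i q : Fin (m + n), (q : ℕ) = i + 1 → Fp q i ∈ coeffSubring A.toSubring := by
      intro i q hiq s
      obtain ⟨k, rfl, rfl⟩ := hlohi i q hiq
      exact neg_mem_iff.1 (hsub _ (Or.inl ⟨k, s, Or.inr (Or.inl rfl)⟩))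
    have hEpA : ∀ i q : Fin (m + n), (q : ℕ) = i + 1 → Ep i q ∈ coeffSubring A.toSubring := by
      intro i q hiq s
      obtain ⟨k, rfl, rfl⟩ := hlohi i q hiq
      exact neg_mem_iff.1 (hsub _ (Or.inl ⟨k, s, Or.inr (Or.inr (Or.inr rfl))⟩))
    have hdmA : ∀ j, dm j ∈ coeffSubring A.toSubring := fun j s =>
      hsub _ (Or.inr ⟨j, s, Or.inl rfl⟩)
    have hdpA : ∀ j, dp j ∈ coeffSubring A.toSubring := fun j s =>
      neg_mem_iff.1 (hsub _ (Or.inr ⟨j, s, Or.inr rfl⟩))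
    -- The products of Gauss factors carry a factor `X`, so off the diagonal the constant
    -- coefficient sees only `F + E`.
    have hfirst : ∀ i j : Fin (m + n), i ≠ j → tFirst i j =
        PowerSeries.constantCoeff (Fm i j) + PowerSeries.constantCoeff (Em i j) := by
      intro i j hij
      have := congrArg PowerSeries.constantCoeff (congrFun (congrFun hTm i) j)
      rw [Matrix.add_apply, Matrix.add_apply, Matrix.add_apply, Matrix.smul_apply, smul_eq_mul,
        mul_assoc, map_add, map_mul, PowerSeries.constantCoeff_X, zero_mul, add_zero,
        Matrix.diagonal_apply_ne _ hij, add_zero, map_add] at this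
      rw [← this]
      simp [tFirst]
    have htA : ∀ i q : Fin (m + n), (q : ℕ) = i + 1 → tFirst i q ∈ A ∧ tFirst q i ∈ A := by
      intro i q hiq
      have hlt : i < q := Fin.lt_def.2 (by omega)
      rw [hfirst i q hlt.ne, hfirst q i hlt.ne', hFm0 i q hlt.le, hEm0 q i hlt.le, map_zero,
        zero_add, add_zero, ← PowerSeries.coeff_zero_eq_constantCoeff_apply,
        ← PowerSeries.coeff_zero_eq_constantCoeff_apply]
      exact ⟨hEmA i q hiq 0, hFmA i q hiq 0⟩
    have hhA : hSeries m n ∈ coeffSubring A.toSubring :=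
      C_mem_coeffSubring (Subalgebra.algebraMap_mem A h)
    have hm := Tmatrix_mem .minus A X_mul_hSeries_commute X_mul_hSeries_regular
      isUnit_one_add_X_mul_hSeries_mul (mul_mem (X_mem_coeffSubring _) hhA) gm hFm hDm hEm hFm0 hEm0
      hTm hFmA hdmA hEmA htA
    -- The same elements `t_{iq}^{(1)}`, obtained from `T⁻`, act on `T⁺` through the mixed relation.
    have hp := Tmatrix_mem .plus A hSeries_commute hSeries_regular isUnit_one_add_hSeries_mul hhA gp
      hFp hDp hEp hFp0 hEp0 hTp hFpA hdpA hEpA htA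
    refine topologicallyGenerates_of_generators fun g => ?_
    cases g with
    | pos i j s => simpa using hm i j s
    | neg i j s => simpa using hp i j s
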